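/- Let $\mathcal X$ be a finite alphabet and let $\mathbf x=(x_1,x_2,\ldots)$ be an arbitrary infinite sequence with $x_i\in\mathcal X$. Write $x_i^j=(x_i,\ldots,x_j)$ and let $\log$ denote the logarithm to base $2$. For a finite string $w$ of length $n\ge 1$ over $\mathcal X$, let $c(w)$ be the number of phrases in its incremental (LZ78) parsing, in which $w$ is read from left to right and each phrase is the shortest string that has not yet appeared as a complete phrase; the final phrase may be incomplete (and so equal to an earlier one) and is counted too. For example, $abbabaabbaaabaa$ is parsed as $a,b,ba,baa,bb,aa,ab,aa$, so that $c=8$. Put $\rho_{\mathrm{LZ}}(w)=\frac{c(w)\log c(w)}{n}$ and, for $k\ge 1$, $$\rho_k(\mathbf x)=\limsup_{n\to\infty}\frac{k}{n}\sum_{i=0}^{n/k-1}\rho_{\mathrm{LZ}}\bigl(x_{ik+1}^{ik+k}\bigr),$$ where $n$ runs over the multiples of $k$. For $d,n\ge 1$ and $w\in\mathcal X^d$, let $$\hat P_n(w)=\frac1n\,\bigl|\{\,0\le i\le n-1:\ x_{((i+j-1)\bmod n)+1}=w_j\ \text{ for } j=1,\ldots,d\,\}\bigr|$$ be the cyclic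 sliding-window empirical distribution of $d$-vectors in $x_1^n$, let $\hat H_{\mathrm{csw}}(X^d)[x^n]=-\sum_{w\in\mathcal X^d}\hat P_n(w)\log\hat P_n(w)$ be its entropy (with $0\log 0=0$), and put $\hat H_{\mathrm{csw}}(X^d)[\mathbf x]=\limsup_{n\to\infty}\hat H_{\mathrm{csw}}(X^d)[x^n]$. Then both limits below exist, are finite, and are equal: $$\lim_{k\to\infty}\rho_k(\mathbf x)=\lim_{d\to\infty}\frac{\hat H_{\mathrm{csw}}(X^d)[\mathbf x]}{d}.$$ -/

import Mathlib

open Filter Topology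

namespace LZ78

/-- Incremental (LZ78) parsing. `phrases` are the completed phrases so far, `cur` is the part of the
current phrase already read, and the last argument is the unread part of the input. A phrase is
completed as soon as it differs from every earlier phrase; a nonempty incomplete remainder at the
end of the input is kept as the final phrase. -/
def parseAux {A : Type*} [DecidableEq A] :
    List (List A) → List A → List A → List (List A)
  | phrases, cur, [] => if cur = [] then phrases else phrases ++ [cur]
  | phrases, cur, a :: rest =>
      if cur ++ [a] ∈ phrases then parseAux phrases (cur ++ [a]) rest
      else parseAux (phrases ++ [cur ++ [a]]) [] rest

/-- The phrases of the incremental parsing of a finite string, in order. -/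
def parse {A : Type*} [DecidableEq A] (w : List A) : List (List A) :=
  parseAux [] [] w

/-- `c(w)`: the number of phrases of the incremental parsing of `w`, including the final one, which
may be incomplete. -/
def phraseCount {A : Type*} [DecidableEq A] (w : List A) : ℕ :=
  (parse w).length

/-- The normalized LZ complexity `c(w) log₂ c(w) / |w|` of a finite string. -/
noncomputable def rhoLZ {A : Type*} [DecidableEq A] (w : List A) : ℝ :=
  (phraseCount w : ℝ) * Real.logb 2 (phraseCount w) / (w.length : ℝ)

/-- The `i`-th block (`i = 0, 1, …`) of length `k` of an infinite sequence. Sequences are indexed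
from `0`, so `x j` is the `(j+1)`-st symbol and this block is `(x_{ik+1}, …, x_{ik+k})`. -/
def block {A : Type*} (x : ℕ → A) (k i : ℕ) : List A :=
  List.ofFn fun j : Fin k => x (i * k + j)

/-- `(k/n) ∑_{i=0}^{n/k-1} ρ_LZ(x_{ik+1}^{ik+k})`, used for `n` a multiple of `k`. -/
noncomputable def blockAverage {A : Type*} [DecidableEq A] (x : ℕ → A) (k n : ℕ) : ℝ :=
  (k : ℝ) / (n : ℝ) * ∑ i ∈ Finset.range (n / k), rhoLZ (block x k i)

/-- `ρ_k(x)`: the limit superior of the block averages as `n → ∞` through the multiples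
`n = N k` of `k`. (The averages lie in `[0, log₂ k]` for `k ≥ 1`.) -/
noncomputable def rhoK {A : Type*} [DecidableEq A] (x : ℕ → A) (k : ℕ) : ℝ :=
  limsup (fun N : ℕ => blockAverage x k (N * k)) atTop

/-- The cyclic sliding-window empirical distribution of `d`-vectors along the first `n` symbols
of `x`: the fraction of the `n` starting positions whose cyclic window of length `d` equals `w`. -/
noncomputable def cswDist {A : Type*} [DecidableEq A] (x : ℕ → A) (n d : ℕ)
    (w : Fin d → A) : ℝ :=
  (1 / (n : ℝ)) *
    ∑ i ∈ Finset.range n, if (fun j : Fin d => x ((i + j) % n)) = w then (1 : ℝ) else 0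

/-- The entropy, in bits, of the cyclic sliding-window empirical distribution of `d`-vectors along
the first `n` symbols of `x`. -/
noncomputable def cswEntropy {A : Type*} [Fintype A] [DecidableEq A]
    (x : ℕ → A) (d n : ℕ) : ℝ :=
  -∑ w : Fin d → A, cswDist x n d w * Real.logb 2 (cswDist x n d w)

/-- The limit superior over `n` of the `d`-th order cyclic sliding-window empirical entropies.
(These lie in `[0, d log₂ |A|]`.) -/
noncomputable def cswEntropySup {A : Type*} [Fintype A] [DecidableEq A]
    (x : ℕ → A) (d : ℕ) : ℝ :=
  limsup (fun n : ℕ => cswEntropy x d n) atTop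

end LZ78

namespace LZ78

/-! Everything rests on comparing ideal code lengths `-log q` of sub-probabilities. Cyclic entropies
are subadditive in `d` (`cswEntropy_add_le`), so by Fekete's lemma `cswEntropySup x d / d` converges
to some `H`; it remains to squeeze `rhoK x k` around `H`. The common tool is `phaseMixture m q`: a
weight on `m`-blocks becomes a weight on strings of any length by multiplying over consecutive
blocks and averaging over the `m` starting phases. For a bounded overhead, its code length is at
most the sum of block costs along whichever residue class mod `m` one likes (`phaseMixture_seg`),
hence also at most `1/m` of the sum over all positions (`phaseMixture_seg_average`). Lower bound for
`rhoK`: LZ78 code lengths satisfy Kraft's inequality (`isSubProb_lzWeight`). Gibbs' inequality for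
long cyclic windows, with the mixture of `lzWeight` and the residue class of the aligned `k`-blocks,
bounds the entropy by the average LZ cost of these blocks (`mul_cswEntropy_le_sum_lzWeight`).
Letting `d → ∞` for fixed `k` removes the overhead per window. Upper bound: by Ziv's inequality
(`length_mul_logb_le`), `c log c` for nearly distinct phrases is at most `c` plus their total code
length under any weight on strings. With the mixture of the empirical distribution of `d`-windows,
the costs over all blocks add up to the entropy (`blockAverage_le_cswEntropy`); the overhead per
phrase is negligible because the number of phrases is sublinear in `k`. -/

/-! ### Segments of a sequence. -/

/-- The segment `z_p, …, z_{p+l-1}` of a sequence. -/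
def seg {A : Type*} (z : ℕ → A) (p l : ℕ) : List A := (List.range' p l).map z

@[simp] theorem length_seg {A : Type*} (z : ℕ → A) (p l : ℕ) : (seg z p l).length = l := by
  simp [seg]

theorem seg_zero {A : Type*} (z : ℕ → A) (p : ℕ) : seg z p 0 = [] := rfl

theorem seg_add {A : Type*} (z : ℕ → A) (p l m : ℕ) :
    seg z p (l + m) = seg z p l ++ seg z (p + l) m := by
  rw [seg, seg, seg, ← List.map_append, List.range'_append_1]

theorem take_seg {A : Type*} (z : ℕ → A) (p s l : ℕ) :
    (seg z p l).take s = seg z p (min s l) := by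
  obtain ⟨e, he⟩ := Nat.exists_eq_add_of_le (min_le_right s l)
  conv_lhs => rw [he, seg_add]
  rcases le_total s l with h | h
  · rw [min_eq_left h, List.take_left' (length_seg _ _ _)]
  · have : e = 0 := by rw [min_eq_right h] at he; omega
    subst this
    rw [min_eq_right h, seg_zero, List.append_nil, List.take_of_length_le (by simpa using h)]

theorem drop_seg {A : Type*} (z : ℕ → A) (p s l : ℕ) :
    (seg z p l).drop s = seg z (p + s) (l - s) := by
  rcases le_total s l with h | h
  · obtain ⟨e, rfl⟩ := Nat.exists_eq_add_of_le h
    rw [seg_add, List.drop_left' (length_seg _ _ _), Nat.add_sub_cancel_left]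
  · rw [Nat.sub_eq_zero_of_le h, seg_zero, List.drop_of_length_le (by simpa using h)]

/-! ### Sub-probabilities on strings and mixtures of block products over phases. -/

/-- `q` is nonnegative and has total mass at most one on the strings of length `l`. -/
structure IsSubProb {A : Type*} (q : List A → ℝ) (l : ℕ) : Prop where
  nonneg : ∀ y, 0 ≤ q y
  sum_le : ∀ S : Finset (List A), (∀ y ∈ S, y.length = l) → ∑ y ∈ S, q y ≤ 1

theorem IsSubProb.le_one {A : Type*} {q : List A → ℝ} {l : ℕ} (h : IsSubProb q l) {y : List A}
    (hy : y.length = l) : q y ≤ 1 := by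
  simpa using h.sum_le {y} (by simpa using hy)

/-- Cutting at `a` is injective, so the sum is dominated by a product of two sums. The length `min a
l` covers cuts beyond the end of the string. -/
theorem IsSubProb.concat {A : Type*} [DecidableEq A] {f g : List A → ℝ} {a l : ℕ}
    (hf : IsSubProb f (min a l)) (hg : IsSubProb g (l - a)) :
    IsSubProb (fun y => f (y.take a) * g (y.drop a)) l where
  nonneg y := mul_nonneg (hf.nonneg _) (hg.nonneg _)
  sum_le S hS := by
    have inj : Set.InjOn (fun y : List A => (y.take a, y.drop a)) S := by
      intro y _ y' _ h
      simp only [Prod.mk.injEq] at h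
      rw [← List.take_append_drop a y, h.1, h.2, List.take_append_drop]
    calc ∑ y ∈ S, f (y.take a) * g (y.drop a)
        = ∑ v ∈ S.image (fun y : List A => (y.take a, y.drop a)), f v.1 * g v.2 := by
          rw [Finset.sum_image inj]
      _ ≤ ∑ v ∈ S.image (List.take a) ×ˢ S.image (List.drop a), f v.1 * g v.2 := by
          refine Finset.sum_le_sum_of_subset_of_nonneg ?_
            fun v _ _ => mul_nonneg (hf.nonneg _) (hg.nonneg _)
          intro v hv
          obtain ⟨y, hy, rfl⟩ := Finset.mem_image.1 hv
          exact Finset.mem_product.2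
            ⟨Finset.mem_image_of_mem _ hy, Finset.mem_image_of_mem _ hy⟩
      _ = (∑ u ∈ S.image (List.take a), f u) * ∑ v ∈ S.image (List.drop a), g v := by
          rw [Finset.sum_product, Finset.sum_mul_sum]
      _ ≤ 1 * 1 := by
          refine mul_le_mul (hf.sum_le _ ?_) (hg.sum_le _ ?_)
            (Finset.sum_nonneg fun _ _ => hg.nonneg _) zero_le_one
          · intro u hu
            obtain ⟨y, hy, rfl⟩ := Finset.mem_image.1 hu
            rw [List.length_take, hS y hy]
          · intro u hu
            obtain ⟨y, hy, rfl⟩ := Finset.mem_image.1 hu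
            rw [List.length_drop, hS y hy]
      _ = 1 := one_mul 1

/-- The uniform distribution on strings of each length. -/
noncomputable def uniform (A : Type*) [Fintype A] (y : List A) : ℝ :=
  ((Fintype.card A : ℝ)⁻¹) ^ y.length

theorem uniform_pos {A : Type*} [Fintype A] [Nonempty A] (y : List A) : 0 < uniform A y :=
  pow_pos (inv_pos.2 (by exact_mod_cast Fintype.card_pos)) _

theorem isSubProb_uniform (A : Type*) [Fintype A] [DecidableEq A] (l : ℕ) :
    IsSubProb (uniform A) l where
  nonneg y := pow_nonneg (by positivity) _
  sum_le S hS := by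
    have hc : S.card ≤ Fintype.card A ^ l := by
      calc S.card ≤ ((Finset.univ : Finset (Fin l → A)).image List.ofFn).card := by
            refine Finset.card_le_card fun y hy => Finset.mem_image.2 ?_
            have := hS y hy
            subst this
            exact ⟨y.get, Finset.mem_univ _, List.ofFn_get y⟩
        _ ≤ _ := Finset.card_image_le.trans (by simp)
    rw [Finset.sum_congr rfl (g := fun _ => ((Fintype.card A : ℝ)⁻¹) ^ l)
      fun y hy => by rw [uniform, hS y hy], Finset.sum_const, nsmul_eq_mul, inv_pow]
    refine mul_inv_le_one_of_le₀ (by exact_mod_cast hc) (by positivity)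

theorem neg_logb_uniform {A : Type*} [Fintype A] (y : List A) :
    -Real.logb 2 (uniform A y) = y.length * Real.logb 2 (Fintype.card A) := by
  rw [uniform, Real.logb_pow, Real.logb_inv]; ring

theorem logb_card_nonneg (A : Type*) [Fintype A] [Nonempty A] :
    0 ≤ Real.logb 2 (Fintype.card A) :=
  Real.logb_nonneg one_lt_two (by exact_mod_cast Fintype.card_pos)

/-- The product weight obtained by cutting a string into blocks of length `m` from the left and
weighting the blocks by `q`; the remainder gets the uniform weight. -/
noncomputable def blockProd {A : Type*} [Fintype A] (m : ℕ) (q : List A → ℝ) (y : List A) : ℝ :=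
  if 0 < m ∧ m ≤ y.length then q (y.take m) * blockProd m q (y.drop m) else uniform A y
termination_by y.length
decreasing_by simp only [List.length_drop]; omega

theorem blockProd_nonneg {A : Type*} [Fintype A] [DecidableEq A] {m : ℕ} {q : List A → ℝ}
    (hq : IsSubProb q m) (y : List A) : 0 ≤ blockProd m q y := by
  induction hy : y.length using Nat.strong_induction_on generalizing y with
  | _ n ih =>
    subst hy
    rw [blockProd]
    split_ifs with h
    · refine mul_nonneg (hq.nonneg _) (ih _ ?_ _ rfl)
      simp only [List.length_drop]; omega
    · exact (isSubProb_uniform A 0).nonneg y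

theorem isSubProb_blockProd {A : Type*} [Fintype A] [DecidableEq A] {m : ℕ} {q : List A → ℝ}
    (hq : IsSubProb q m) (l : ℕ) : IsSubProb (blockProd m q) l where
  nonneg := blockProd_nonneg hq
  sum_le := by
    induction l using Nat.strong_induction_on with
    | _ l ih =>
      intro S hS
      by_cases h : 0 < m ∧ m ≤ l
      · have := (IsSubProb.concat (f := q) (g := blockProd m q) (a := m) (l := l)
          (by rwa [min_eq_left h.2]) ⟨blockProd_nonneg hq, ih (l - m) (by omega)⟩).sum_le S hS
        rwa [Finset.sum_congr rfl fun y hy => by rw [blockProd, hS y hy, if_pos h]]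
      · rw [Finset.sum_congr rfl fun y hy => by rw [blockProd, hS y hy, if_neg h]]
        exact (isSubProb_uniform A l).sum_le S hS

/-- The cuts fall at positions congruent to `p`, and the uncut tail, shorter than `m`, pays the
uniform cost. The sum may also contain a block that overruns the segment; this is harmless since all
costs are nonnegative. -/
theorem blockProd_seg {A : Type*} [Fintype A] [Nonempty A] {m : ℕ} (hm : 0 < m) {q : List A → ℝ}
    (hq : IsSubProb q m) {z : ℕ → A} (hz : ∀ i, 0 < q (seg z i m)) (l p : ℕ) :
    0 < blockProd m q (seg z p l) ∧
    -Real.logb 2 (blockProd m q (seg z p l)) ≤ m * Real.logb 2 (Fintype.card A) +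
      ∑ i ∈ Finset.Ico p (p + l) with i % m = p % m, -Real.logb 2 (q (seg z i m)) := by
  have F0 : ∀ i, 0 ≤ -Real.logb 2 (q (seg z i m)) := fun i =>
    neg_nonneg.2 (Real.logb_nonpos one_lt_two (hz i).le (hq.le_one (length_seg _ _ _)))
  induction l using Nat.strong_induction_on generalizing p with
  | _ l ih =>
    rw [blockProd, length_seg]
    by_cases h : 0 < m ∧ m ≤ l
    · obtain ⟨h1, h2⟩ := ih (l - m) (by omega) (p + m)
      rw [if_pos h, take_seg, drop_seg, min_eq_left h.2]
      refine ⟨mul_pos (hz p) h1, ?_⟩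
      rw [Real.logb_mul (hz p).ne' h1.ne']
      have hsub : insert p ({i ∈ Finset.Ico (p + m) (p + m + (l - m)) | i % m = (p + m) % m}) ⊆
          {i ∈ Finset.Ico p (p + l) | i % m = p % m} := by
        intro i hi
        simp only [Finset.mem_insert, Finset.mem_filter, Finset.mem_Ico, Nat.add_mod_right] at hi ⊢
        rcases hi with rfl | hi
        · exact ⟨⟨le_rfl, by omega⟩, rfl⟩
        · exact ⟨by omega, hi.2⟩
      have := Finset.sum_le_sum_of_subset_of_nonneg hsub fun i _ _ => F0 i
      rw [Finset.sum_insert (by simp; omega)] at this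
      linarith
    · rw [if_neg h]
      refine ⟨uniform_pos _, ?_⟩
      rw [neg_logb_uniform, length_seg]
      have h3 : (l : ℝ) ≤ m := by
        have : l ≤ m := by omega
        exact_mod_cast this
      have h4 := mul_le_mul_of_nonneg_right h3 (logb_card_nonneg A)
      have h5 : 0 ≤ ∑ i ∈ Finset.Ico p (p + l) with i % m = p % m, -Real.logb 2 (q (seg z i m)) :=
        Finset.sum_nonneg fun i _ => F0 i
      linarith

/-- Cutting into blocks after `s` initial symbols of uniform weight. -/
noncomputable def shiftedBlockProd {A : Type*} [Fintype A] (m : ℕ) (q : List A → ℝ) (s : ℕ)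
    (y : List A) : ℝ :=
  uniform A (y.take s) * blockProd m q (y.drop s)

/-- The average of the block products over all phases. -/
noncomputable def phaseMixture {A : Type*} [Fintype A] (m : ℕ) (q : List A → ℝ)
    (y : List A) : ℝ :=
  (m : ℝ)⁻¹ * ∑ s ∈ Finset.range m, shiftedBlockProd m q s y

theorem isSubProb_phaseMixture {A : Type*} [Fintype A] [DecidableEq A] {m : ℕ} {q : List A → ℝ}
    (hq : IsSubProb q m) (l : ℕ) : IsSubProb (phaseMixture m q) l := by
  have h : ∀ s, IsSubProb (shiftedBlockProd m q s) l := fun s =>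
    IsSubProb.concat (isSubProb_uniform A _) (isSubProb_blockProd hq _)
  refine ⟨fun y => mul_nonneg (by positivity) (Finset.sum_nonneg fun s _ => (h s).nonneg y), ?_⟩
  intro S hS
  simp only [phaseMixture]
  rw [← Finset.mul_sum, Finset.sum_comm]
  calc (m : ℝ)⁻¹ * ∑ s ∈ Finset.range m, ∑ y ∈ S, shiftedBlockProd m q s y
      ≤ (m : ℝ)⁻¹ * ∑ s ∈ Finset.range m, 1 := by
        gcongr with s _
        exact (h s).sum_le S hS
    _ ≤ 1 := by simpa using inv_mul_le_one

theorem exists_phase {m : ℕ} (hm : 0 < m) (p t : ℕ) : ∃ s < m, (p + s) % m = t % m := by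
  refine ⟨(t + (m - p % m)) % m, Nat.mod_lt _ hm, ?_⟩
  have h1 := Nat.mod_lt p hm
  have h2 := Nat.div_add_mod p m
  rw [Nat.add_mod_mod]
  have : p + (t + (m - p % m)) = t + m * (p / m + 1) := by rw [mul_add]; omega
  rw [this, Nat.add_mul_mod_self_left]

/-- The residue `t` is free: the mixture dominates `1/m` times the product whose cuts are congruent
to `t`, which costs `log m`. The head before the first cut and the tail after the last one each cost
at most `m log |A|`. -/
theorem phaseMixture_seg {A : Type*} [Fintype A] [Nonempty A] [DecidableEq A] {m : ℕ}
    (hm : 0 < m) {q : List A → ℝ} (hq : IsSubProb q m) {z : ℕ → A}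
    (hz : ∀ i, 0 < q (seg z i m)) (l p t : ℕ) :
    0 < phaseMixture m q (seg z p l) ∧
    -Real.logb 2 (phaseMixture m q (seg z p l)) ≤
      Real.logb 2 m + 2 * m * Real.logb 2 (Fintype.card A) +
      ∑ i ∈ Finset.Ico p (p + l) with i % m = t % m, -Real.logb 2 (q (seg z i m)) := by
  have F0 : ∀ i, 0 ≤ -Real.logb 2 (q (seg z i m)) := fun i =>
    neg_nonneg.2 (Real.logb_nonpos one_lt_two (hz i).le (hq.le_one (length_seg _ _ _)))
  obtain ⟨s, hs, hst⟩ := exists_phase hm p t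
  have hm' : (0 : ℝ) < (m : ℝ)⁻¹ := by positivity
  have hle : (m : ℝ)⁻¹ * shiftedBlockProd m q s (seg z p l) ≤ phaseMixture m q (seg z p l) := by
    refine mul_le_mul_of_nonneg_left ?_ hm'.le
    refine Finset.single_le_sum (f := fun s => shiftedBlockProd m q s (seg z p l)) (fun s _ => ?_)
      (Finset.mem_range.2 hs)
    exact mul_nonneg (uniform_pos _).le ((isSubProb_blockProd hq 0).nonneg _)
  obtain ⟨h1, h2⟩ := blockProd_seg hm hq hz (l - s) (p + s)
  have h3 : 0 < shiftedBlockProd m q s (seg z p l) := by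
    rw [shiftedBlockProd, drop_seg]
    exact mul_pos (uniform_pos _) h1
  have h4 := mul_pos hm' h3
  refine ⟨h4.trans_le hle, ?_⟩
  have h5 := Real.logb_le_logb_of_le one_lt_two h4 hle
  rw [Real.logb_mul hm'.ne' h3.ne', Real.logb_inv, shiftedBlockProd, drop_seg,
    Real.logb_mul (uniform_pos _).ne' h1.ne'] at h5
  have h6 := neg_logb_uniform ((seg z p l).take s)
  have h7 : (((seg z p l).take s).length : ℝ) ≤ m := by
    have : ((seg z p l).take s).length ≤ m := by simp; omega
    exact_mod_cast this
  have h8 := mul_le_mul_of_nonneg_right h7 (logb_card_nonneg A)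
  have hsub : {i ∈ Finset.Ico (p + s) (p + s + (l - s)) | i % m = (p + s) % m} ⊆
      {i ∈ Finset.Ico p (p + l) | i % m = t % m} := by
    intro i hi
    simp only [Finset.mem_filter, Finset.mem_Ico, hst] at hi ⊢
    exact ⟨by omega, hi.2⟩
  have := Finset.sum_le_sum_of_subset_of_nonneg hsub fun i _ _ => F0 i
  linarith

/-- The bound for a single residue is averaged over all `m` residues. -/
theorem phaseMixture_seg_average {A : Type*} [Fintype A] [Nonempty A] [DecidableEq A] {m : ℕ}
    (hm : 0 < m) {q : List A → ℝ} (hq : IsSubProb q m) {z : ℕ → A}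
    (hz : ∀ i, 0 < q (seg z i m)) (l p : ℕ) :
    -Real.logb 2 (phaseMixture m q (seg z p l)) ≤
      Real.logb 2 m + 2 * m * Real.logb 2 (Fintype.card A) +
      (∑ i ∈ Finset.Ico p (p + l), -Real.logb 2 (q (seg z i m))) / m := by
  have h := Finset.sum_le_sum fun t (_ : t ∈ Finset.range m) =>
    (phaseMixture_seg hm hq hz l p t).2
  have e : ∑ t ∈ Finset.range m, ∑ i ∈ Finset.Ico p (p + l) with i % m = t % m,
      -Real.logb 2 (q (seg z i m)) = ∑ i ∈ Finset.Ico p (p + l), -Real.logb 2 (q (seg z i m)) := by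
    rw [← Finset.sum_fiberwise_of_maps_to (s := Finset.Ico p (p + l)) (t := Finset.range m)
      (g := fun i => i % m) fun i _ => Finset.mem_range.2 (Nat.mod_lt _ hm)]
    refine Finset.sum_congr rfl fun t ht => ?_
    rw [Nat.mod_eq_of_lt (Finset.mem_range.1 ht)]
  rw [Finset.sum_const, Finset.card_range, nsmul_eq_mul, Finset.sum_add_distrib, Finset.sum_const,
    Finset.card_range, nsmul_eq_mul, e] at h
  have hm' : (0 : ℝ) < m := by exact_mod_cast hm
  rw [← mul_le_mul_iff_right₀ hm', mul_add, mul_div_cancel₀ _ hm'.ne']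
  exact h

/-! ### Cyclic empirical entropy: Gibbs' inequality and subadditivity. -/

/-- The cyclic empirical distribution of `x_0, …, x_{n-1}` as a weight on strings of length `d`. -/
noncomputable def empirical {A : Type*} [DecidableEq A] (x : ℕ → A) (n d : ℕ) (y : List A) : ℝ :=
  ({i ∈ Finset.range n | seg (fun j => x (j % n)) i d = y} : Finset ℕ).card / (n : ℝ)

theorem isSubProb_empirical {A : Type*} [DecidableEq A] (x : ℕ → A) (n d l : ℕ) :
    IsSubProb (empirical x n d) l where
  nonneg y := by unfold empirical; positivity
  sum_le S _ := by
    simp only [empirical]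
    rw [← Finset.sum_div, ← Nat.cast_sum]
    refine div_le_one_of_le₀ ?_ (Nat.cast_nonneg n)
    rw [Finset.sum_card_fiberwise_eq_card_filter]
    exact_mod_cast (Finset.card_filter_le _ _).trans (Finset.card_range n).le

theorem seg_mod {A : Type*} (x : ℕ → A) (n i d : ℕ) :
    seg (fun j => x (j % n)) (i % n) d = seg (fun j => x (j % n)) i d := by
  simp only [seg, List.range'_eq_map_range, List.map_map]
  refine List.map_congr_left fun j _ => ?_
  simp

theorem empirical_pos {A : Type*} [DecidableEq A] (x : ℕ → A) {n : ℕ} (hn : 0 < n) (d i : ℕ) :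
    0 < empirical x n d (seg (fun j => x (j % n)) i d) := by
  refine div_pos ?_ (by exact_mod_cast hn)
  rw [Nat.cast_pos, Finset.card_pos]
  exact ⟨i % n, Finset.mem_filter.2 ⟨Finset.mem_range.2 (Nat.mod_lt _ hn), seg_mod _ _ _ _⟩⟩

theorem seg_eq_ofFn {A : Type*} (z : ℕ → A) (p d : ℕ) :
    seg z p d = List.ofFn fun j : Fin d => z (p + j) := by
  refine List.ext_getElem (by simp) fun i h1 h2 => ?_
  simp [seg]

theorem cswDist_eq_empirical {A : Type*} [DecidableEq A] (x : ℕ → A) (n d : ℕ) (w : Fin d → A) :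
    cswDist x n d w = empirical x n d (List.ofFn w) := by
  rw [cswDist, empirical, Finset.sum_boole, one_div, div_eq_inv_mul]
  simp only [seg_eq_ofFn, List.ofFn_inj]

theorem sum_seg_eq_sum_empirical {A : Type*} [DecidableEq A] (x : ℕ → A) {n : ℕ} (hn : 0 < n)
    (d : ℕ) (f : List A → ℝ) {S : Finset (List A)}
    (hS : ∀ i < n, seg (fun j => x (j % n)) i d ∈ S) :
    ∑ i ∈ Finset.range n, f (seg (fun j => x (j % n)) i d) =
      n * ∑ y ∈ S, empirical x n d y * f y := by
  rw [← Finset.sum_fiberwise_of_maps_to (s := Finset.range n) (t := S)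
    (g := fun i => seg (fun j => x (j % n)) i d) fun i hi => hS i (Finset.mem_range.1 hi),
    Finset.mul_sum]
  refine Finset.sum_congr rfl fun y _ => ?_
  rw [Finset.sum_congr rfl (g := fun _ => f y) fun i hi => by rw [(Finset.mem_filter.1 hi).2],
    Finset.sum_const, nsmul_eq_mul, empirical]
  have : (n : ℝ) ≠ 0 := by exact_mod_cast hn.ne'
  field_simp

/-- Entropy as a sum of code lengths over positions is the form in which it is compared with other
codes. -/
theorem mul_cswEntropy {A : Type*} [Fintype A] [DecidableEq A] (x : ℕ → A) {n : ℕ} (hn : 0 < n)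
    (d : ℕ) : n * cswEntropy x d n = ∑ i ∈ Finset.range n,
      -Real.logb 2 (empirical x n d (seg (fun j => x (j % n)) i d)) := by
  rw [sum_seg_eq_sum_empirical x hn d (fun y => -Real.logb 2 (empirical x n d y))
    (S := Finset.univ.image (List.ofFn : (Fin d → A) → List A)) fun i _ => by
      rw [seg_eq_ofFn]; exact Finset.mem_image_of_mem _ (Finset.mem_univ _),
    Finset.sum_image (List.ofFn_injective.injOn), cswEntropy, ← Finset.sum_neg_distrib]
  simp only [cswDist_eq_empirical, mul_neg]

/-- Gibbs' inequality for the empirical distribution. -/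
theorem mul_cswEntropy_le {A : Type*} [Fintype A] [DecidableEq A] (x : ℕ → A) {n : ℕ}
    (hn : 0 < n) {d : ℕ} {q : List A → ℝ} (hq : IsSubProb q d)
    (hpos : ∀ i < n, 0 < q (seg (fun j => x (j % n)) i d)) :
    n * cswEntropy x d n ≤ ∑ i ∈ Finset.range n,
      -Real.logb 2 (q (seg (fun j => x (j % n)) i d)) := by
  rw [mul_cswEntropy x hn, ← sub_nonpos, ← Finset.sum_sub_distrib]
  have hl : 0 < Real.log 2 := Real.log_pos one_lt_two
  have key : ∀ i ∈ Finset.range n,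
      -Real.logb 2 (empirical x n d (seg (fun j => x (j % n)) i d)) -
        -Real.logb 2 (q (seg (fun j => x (j % n)) i d)) ≤
      (q (seg (fun j => x (j % n)) i d) / empirical x n d (seg (fun j => x (j % n)) i d) - 1) /
        Real.log 2 := by
    intro i hi
    have h1 := empirical_pos x hn d i
    have h2 := hpos i (Finset.mem_range.1 hi)
    have h3 := Real.log_le_sub_one_of_pos (div_pos h2 h1)
    rw [Real.log_div h2.ne' h1.ne'] at h3
    rw [Real.logb, Real.logb, ← neg_div, ← neg_div, ← sub_div]
    exact div_le_div_of_nonneg_right (by linarith) hl.le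
  refine (Finset.sum_le_sum key).trans ?_
  rw [← Finset.sum_div]
  refine div_nonpos_of_nonpos_of_nonneg ?_ hl.le
  rw [Finset.sum_sub_distrib, Finset.sum_const, Finset.card_range, nsmul_eq_mul, mul_one,
    sub_nonpos,
    sum_seg_eq_sum_empirical x hn d (fun y => q y / empirical x n d y)
      (S := (Finset.range n).image fun i => seg (fun j => x (j % n)) i d) fun i hi =>
        Finset.mem_image_of_mem _ (Finset.mem_range.2 hi)]
  -- On the windows that occur, the empirical weight cancels and only the total `q`-mass of these
  -- windows remains.
  refine mul_le_of_le_one_right (Nat.cast_nonneg n) ?_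
  refine le_trans (le_of_eq (Finset.sum_congr rfl fun y hy => ?_))
    (hq.sum_le ((Finset.range n).image fun i => seg (fun j => x (j % n)) i d) fun y hy => ?_)
  · obtain ⟨i, _, rfl⟩ := Finset.mem_image.1 hy
    exact mul_div_cancel₀ _ (empirical_pos x hn d i).ne'
  · obtain ⟨i, _, rfl⟩ := Finset.mem_image.1 hy
    exact length_seg _ _ _

/-- A shift by one exchanges the term at `0` for the term at `n`, and these agree by periodicity. -/
theorem sum_range_seg_add {A : Type*} (x : ℕ → A) (n d e : ℕ) (f : List A → ℝ) :
    ∑ i ∈ Finset.range n, f (seg (fun j => x (j % n)) (i + d) e) =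
      ∑ i ∈ Finset.range n, f (seg (fun j => x (j % n)) i e) := by
  induction d with
  | zero => rfl
  | succ d ih =>
    rw [← ih]
    have h1 := Finset.sum_range_succ (fun i => f (seg (fun j => x (j % n)) (i + d) e)) n
    have h2 := Finset.sum_range_succ' (fun i => f (seg (fun j => x (j % n)) (i + d) e)) n
    have h3 : seg (fun j => x (j % n)) (n + d) e = seg (fun j => x (j % n)) (0 + d) e := by
      rw [← seg_mod, Nat.add_mod_left, seg_mod, zero_add]
    rw [h3] at h1
    simp only [show ∀ i, i + 1 + d = i + (d + 1) from fun i => by ring] at h2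
    linarith

/-- Gibbs' inequality against the product of the `d`- and `e`-distributions. Thanks to the cyclic
convention the last `e` symbols of the windows have exactly the empirical `e`-distribution, so there
is no edge term. -/
theorem cswEntropy_add_le {A : Type*} [Fintype A] [DecidableEq A] (x : ℕ → A) {n : ℕ}
    (hn : 0 < n) (d e : ℕ) :
    cswEntropy x (d + e) n ≤ cswEntropy x d n + cswEntropy x e n := by
  have hn' : (0 : ℝ) < n := by exact_mod_cast hn
  rw [← mul_le_mul_iff_right₀ hn', mul_add]
  have hq : IsSubProb (fun y => empirical x n d (y.take d) * empirical x n e (y.drop d)) (d + e) :=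
    IsSubProb.concat (isSubProb_empirical _ _ _ _) (isSubProb_empirical _ _ _ _)
  have ht : ∀ i, (seg (fun j => x (j % n)) i (d + e)).take d = seg (fun j => x (j % n)) i d := by
    intro i; rw [take_seg, min_eq_left (Nat.le_add_right d e)]
  have hd : ∀ i, (seg (fun j => x (j % n)) i (d + e)).drop d =
      seg (fun j => x (j % n)) (i + d) e := by
    intro i; rw [drop_seg, Nat.add_sub_cancel_left]
  refine (mul_cswEntropy_le x hn hq fun i _ => ?_).trans (le_of_eq ?_)
  · rw [ht, hd]
    exact mul_pos (empirical_pos x hn d i) (empirical_pos x hn e _)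
  · rw [mul_cswEntropy x hn, mul_cswEntropy x hn,
      ← sum_range_seg_add x n d e fun y => -Real.logb 2 (empirical x n e y),
      ← Finset.sum_add_distrib]
    refine Finset.sum_congr rfl fun i _ => ?_
    rw [ht, hd, Real.logb_mul (empirical_pos x hn d i).ne' (empirical_pos x hn e _).ne']
    ring

theorem cswEntropy_nonneg {A : Type*} [Fintype A] [DecidableEq A] (x : ℕ → A) (d : ℕ) {n : ℕ}
    (hn : 0 < n) : 0 ≤ cswEntropy x d n := by
  have hn' : (0 : ℝ) < n := by exact_mod_cast hn
  refine nonneg_of_mul_nonneg_right ?_ hn'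
  rw [mul_cswEntropy x hn]
  exact Finset.sum_nonneg fun i _ => neg_nonneg.2 (Real.logb_nonpos one_lt_two
    (empirical_pos x hn d i).le ((isSubProb_empirical x n d d).le_one (length_seg _ _ _)))

theorem cswEntropy_le {A : Type*} [Fintype A] [DecidableEq A] (x : ℕ → A) (d : ℕ) {n : ℕ}
    (hn : 0 < n) : cswEntropy x d n ≤ d * Real.logb 2 (Fintype.card A) := by
  have : Nonempty A := ⟨x 0⟩
  have hn' : (0 : ℝ) < n := by exact_mod_cast hn
  rw [← mul_le_mul_iff_right₀ hn']
  refine (mul_cswEntropy_le x hn (isSubProb_uniform A d) fun i _ => uniform_pos _).trans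
    (le_of_eq ?_)
  simp only [neg_logb_uniform, length_seg]
  simp

theorem isBoundedUnder_cswEntropy {A : Type*} [Fintype A] [DecidableEq A] (x : ℕ → A) (d : ℕ) :
    IsBoundedUnder (· ≤ ·) atTop fun n => cswEntropy x d n :=
  ⟨_, eventually_map.2 ((eventually_gt_atTop 0).mono fun _ hn => cswEntropy_le x d hn)⟩

theorem isCoboundedUnder_cswEntropy {A : Type*} [Fintype A] [DecidableEq A] (x : ℕ → A) (d : ℕ) :
    IsCoboundedUnder (· ≤ ·) atTop fun n => cswEntropy x d n :=
  IsBoundedUnder.isCoboundedUnder_le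
    ⟨0, eventually_map.2 ((eventually_gt_atTop 0).mono fun _ hn => cswEntropy_nonneg x d hn)⟩

theorem eventually_cswEntropy_lt {A : Type*} [Fintype A] [DecidableEq A] (x : ℕ → A) (d : ℕ)
    {b : ℝ} (hb : cswEntropySup x d < b) : ∀ᶠ n in atTop, cswEntropy x d n < b :=
  eventually_lt_of_limsup_lt hb (isBoundedUnder_cswEntropy x d)

theorem cswEntropySup_le {A : Type*} [Fintype A] [DecidableEq A] (x : ℕ → A) (d : ℕ) {b : ℝ}
    (hb : ∀ᶠ n in atTop, cswEntropy x d n ≤ b) : cswEntropySup x d ≤ b :=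
  limsup_le_of_le (isCoboundedUnder_cswEntropy x d) hb

theorem cswEntropySup_nonneg {A : Type*} [Fintype A] [DecidableEq A] (x : ℕ → A) (d : ℕ) :
    0 ≤ cswEntropySup x d :=
  le_limsup_of_frequently_le
    ((eventually_gt_atTop 0).mono fun _ hn => cswEntropy_nonneg x d hn).frequently
    (isBoundedUnder_cswEntropy x d)

theorem subadditive_cswEntropySup {A : Type*} [Fintype A] [DecidableEq A] (x : ℕ → A) :
    Subadditive (cswEntropySup x) := by
  intro d e
  refine le_of_forall_pos_le_add fun ε hε => cswEntropySup_le x _ ?_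
  filter_upwards [eventually_cswEntropy_lt x d (lt_add_of_pos_right _ (half_pos hε)),
    eventually_cswEntropy_lt x e (lt_add_of_pos_right _ (half_pos hε)), eventually_gt_atTop 0]
    with n h1 h2 hn
  linarith [cswEntropy_add_le x hn d e]

theorem bddBelow_cswEntropySup_div {A : Type*} [Fintype A] [DecidableEq A] (x : ℕ → A) :
    BddBelow (Set.range fun d : ℕ => cswEntropySup x d / d) :=
  ⟨0, by rintro _ ⟨d, rfl⟩; exact div_nonneg (cswEntropySup_nonneg x d) (Nat.cast_nonneg d)⟩

/-! ### Combinatorics of incremental parsing. -/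

/-- What incremental parsing guarantees about a partial parsing: every phrase extends the empty
string or an earlier phrase by one symbol. -/
inductive IsParsing {A : Type*} : List (List A) → Prop
  | nil : IsParsing []
  | snoc {ph : List (List A)} {u : List A} (a : A) (h : IsParsing ph) (hu : u ∈ [] :: ph) :
      IsParsing (ph ++ [u ++ [a]])

theorem flatten_parseAux {A : Type*} [DecidableEq A] (ph : List (List A)) (cur w : List A) :
    (parseAux ph cur w).flatten = ph.flatten ++ cur ++ w := by
  induction w generalizing ph cur with
  | nil =>
    rw [parseAux]
    split_ifs with h <;> simp [h]
  | cons a w ih =>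
    rw [parseAux]
    split_ifs with h <;> simp [ih]

theorem flatten_parse {A : Type*} [DecidableEq A] (w : List A) : (parse w).flatten = w := by
  simp [parse, flatten_parseAux]

/-- Two invariants on `cur` are needed: it is empty or an earlier phrase, so that it may be extended
to a new phrase; and, if nonempty, it extends such a string by one symbol, so that it may stand as
the incomplete final phrase. -/
theorem isParsing_parseAux {A : Type*} [DecidableEq A] {ph : List (List A)} {cur : List A}
    (w : List A) (h : IsParsing ph) (hcur : cur ∈ [] :: ph)
    (hcur' : cur = [] ∨ ∃ u a, u ∈ [] :: ph ∧ cur = u ++ [a]) :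
    IsParsing (parseAux ph cur w) := by
  induction w generalizing ph cur with
  | nil =>
    rw [parseAux]
    split_ifs with h0
    · exact h
    · obtain ⟨u, a, hu, rfl⟩ := hcur'.resolve_left h0
      exact h.snoc a hu
  | cons a w ih =>
    rw [parseAux]
    split_ifs with h0
    · exact ih h (List.mem_cons_of_mem _ h0) (Or.inr ⟨cur, a, hcur, rfl⟩)
    · exact ih (h.snoc a hcur) List.mem_cons_self (Or.inl rfl)

theorem isParsing_parse {A : Type*} [DecidableEq A] (w : List A) : IsParsing (parse w) :=
  isParsing_parseAux w .nil List.mem_cons_self (Or.inl rfl)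

theorem IsParsing.ne_nil {A : Type*} {ph : List (List A)} (h : IsParsing ph) :
    ∀ y ∈ ph, y ≠ [] := by
  induction h with
  | nil => simp
  | snoc a h hu ih =>
    intro y hy
    rcases List.mem_append.1 hy with hy | hy
    · exact ih y hy
    · rw [List.mem_singleton.1 hy]; simp

theorem parseAux_eq_append {A : Type*} [DecidableEq A] {ph : List (List A)} (cur w : List A)
    (h : ph.Nodup) :
    ∃ l r, parseAux ph cur w = l ++ r ∧ l.Nodup ∧ r.length ≤ 1 := by
  induction w generalizing ph cur with
  | nil =>
    rw [parseAux]
    split_ifs with h0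
    · exact ⟨ph, [], by simp, h, by simp⟩
    · exact ⟨ph, [cur], rfl, h, by simp⟩
  | cons a w ih =>
    rw [parseAux]
    split_ifs with h0
    · exact ih _ h
    · exact ih _ (List.concat_eq_append ▸ h.concat h0)

/-- All phrases but the last are distinct. -/
theorem parse_eq_append {A : Type*} [DecidableEq A] (w : List A) :
    ∃ l r, parse w = l ++ r ∧ l.Nodup ∧ r.length ≤ 1 :=
  parseAux_eq_append [] w List.nodup_nil

theorem mul_length_le_length_flatten {A : Type*} {ph : List (List A)} {m : ℕ}
    (h : ∀ y ∈ ph, m ≤ y.length) : ph.length * m ≤ ph.flatten.length := by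
  induction ph with
  | nil => simp
  | cons y ph ih =>
    simp only [List.mem_cons, forall_eq_or_imp] at h
    have := ih h.2
    simp only [List.flatten_cons, List.length_append, List.length_cons, add_mul]
    omega

theorem phraseCount_le_length {A : Type*} [DecidableEq A] (w : List A) :
    phraseCount w ≤ w.length := by
  have := mul_length_le_length_flatten (m := 1) fun y hy =>
    List.length_pos_iff.2 ((isParsing_parse w).ne_nil y hy)
  rwa [flatten_parse, mul_one] at this

/-- The number of phrases is sublinear. -/
theorem exists_phraseCount_le {A : Type*} [Fintype A] [DecidableEq A] {η : ℝ} (hη : 0 < η) :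
    ∃ K : ℕ, ∀ w : List A, K ≤ w.length → (phraseCount w : ℝ) ≤ η * w.length := by
  obtain ⟨m, hm⟩ := exists_nat_gt (2 / η)
  have hm0 : (0 : ℝ) < m := lt_trans (by positivity) hm
  -- Distinct phrases shorter than `m` number at most `T.card`; those of length at least `m` number
  -- at most `w.length / m`, below `η/2` times the length. The choice of `K` makes `T.card + 1` at
  -- most the other half, the `1` being the possibly repeated last phrase.
  set T : Finset (List A) := (List.finite_length_le A m).toFinset with hT
  obtain ⟨K, hK⟩ := exists_nat_gt (2 * ((T.card : ℝ) + 1) / η)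
  refine ⟨K, fun w hw => ?_⟩
  obtain ⟨l, r, hp, hl, hr⟩ := parse_eq_append w
  have h1 : phraseCount w ≤ (l.filter fun y => m ≤ y.length).length + T.card + 1 := by
    rw [phraseCount, hp, List.length_append]
    have h2 : l.length = (l.filter fun y => m ≤ y.length).length +
        (l.filter fun y => ¬ m ≤ y.length).length := by
      simpa only [decide_not] using
        List.length_eq_length_filter_add (l := l) fun y : List A => decide (m ≤ y.length)
    have h3 : (l.filter fun y => ¬ m ≤ y.length).length ≤ T.card := by
      rw [← List.toFinset_card_of_nodup (hl.filter _)]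
      refine Finset.card_le_card fun y hy => ?_
      rw [List.mem_toFinset, List.mem_filter, decide_eq_true_iff, not_le] at hy
      exact (Set.Finite.mem_toFinset _).2 hy.2.le
    omega
  have h4 : (l.filter fun y => m ≤ y.length).length * m ≤ w.length := by
    refine (mul_length_le_length_flatten (m := m) fun y hy => by
      simpa using (List.mem_filter.1 hy).2).trans ?_
    conv_rhs => rw [← flatten_parse w, hp]
    rw [List.flatten_append, List.length_append]
    exact ((List.filter_sublist).flatten.length_le).trans (Nat.le_add_right _ _)
  have h5 : (2 / η) * ((l.filter fun y => m ≤ y.length).length : ℝ) ≤ w.length := by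
    refine (mul_le_mul_of_nonneg_right hm.le (Nat.cast_nonneg _)).trans ?_
    rw [mul_comm]
    exact_mod_cast h4
  have h6 : 2 * ((T.card : ℝ) + 1) / η ≤ w.length := hK.le.trans (by exact_mod_cast hw)
  have h1' : (phraseCount w : ℝ) ≤ ((l.filter fun y => m ≤ y.length).length : ℝ) + T.card + 1 := by
    exact_mod_cast h1
  rw [div_mul_eq_mul_div, div_le_iff₀ hη] at h5
  rw [div_le_iff₀ hη] at h6
  linarith

/-! ### Kraft's inequality for the LZ code. -/

/-- The possible phrase lists of length `c`. -/
def parsings (A : Type*) [Fintype A] [DecidableEq A] : ℕ → Finset (List (List A))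
  | 0 => {[]}
  | c + 1 => (parsings A c ×ˢ (Finset.range (c + 1) ×ˢ (Finset.univ : Finset A))).image
      fun v => v.1 ++ [([] :: v.1).getD v.2.1 [] ++ [v.2.2]]

theorem IsParsing.mem_parsings {A : Type*} [Fintype A] [DecidableEq A] {ph : List (List A)}
    (h : IsParsing ph) : ph ∈ parsings A ph.length := by
  induction h with
  | nil => simp [parsings]
  | @snoc ph u a h hu ih =>
    rw [List.length_append, List.length_singleton, parsings]
    obtain ⟨i, hi, rfl⟩ := List.mem_iff_getElem.1 hu
    refine Finset.mem_image.2 ⟨(ph, i, a), ?_, ?_⟩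
    · simpa using ⟨ih, by simpa using hi⟩
    · simp only [List.getD_eq_getElem _ _ hi]

/-- Each new phrase is determined by a predecessor, possibly empty, among at most `c` candidates,
and a last symbol. -/
theorem card_parsings_le (A : Type*) [Fintype A] [DecidableEq A] (c : ℕ) :
    (parsings A c).card ≤ (c * Fintype.card A) ^ c := by
  induction c with
  | zero => simp [parsings]
  | succ c ih =>
    refine Finset.card_image_le.trans ?_
    rw [Finset.card_product, Finset.card_product, Finset.card_range, Finset.card_univ, pow_succ]
    refine Nat.mul_le_mul_right _ (ih.trans (Nat.pow_le_pow_left ?_ _))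
    exact Nat.mul_le_mul_right _ (Nat.le_succ c)

/-- The sub-probability attached to the LZ code. -/
noncomputable def lzWeight {A : Type*} [Fintype A] [DecidableEq A] (w : List A) : ℝ :=
  (((w.length + 1) * (phraseCount w * Fintype.card A) ^ phraseCount w : ℕ) : ℝ)⁻¹

theorem lzWeight_denominator_pos {A : Type*} [Fintype A] [DecidableEq A] [Nonempty A]
    (w : List A) : 0 < (phraseCount w * Fintype.card A) ^ phraseCount w := by
  rcases Nat.eq_zero_or_pos (phraseCount w) with h | h
  · simp [h]
  · exact pow_pos (Nat.mul_pos h Fintype.card_pos) _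

theorem lzWeight_pos {A : Type*} [Fintype A] [DecidableEq A] [Nonempty A] (w : List A) :
    0 < lzWeight w :=
  inv_pos.2 (Nat.cast_pos.2 (Nat.mul_pos (Nat.succ_pos _) (lzWeight_denominator_pos w)))

theorem neg_logb_lzWeight {A : Type*} [Fintype A] [DecidableEq A] [Nonempty A] (w : List A) :
    -Real.logb 2 (lzWeight w) = Real.logb 2 (w.length + 1) +
      phraseCount w * Real.logb 2 (phraseCount w) +
      phraseCount w * Real.logb 2 (Fintype.card A) := by
  have h1 := (lzWeight_denominator_pos w).ne'
  rw [lzWeight, Real.logb_inv, neg_neg, Nat.cast_mul,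
    Real.logb_mul (by positivity) (Nat.cast_ne_zero.2 h1)]
  push_cast
  rw [Real.logb_pow]
  rcases Nat.eq_zero_or_pos (phraseCount w) with h | h
  · simp [h]
  · rw [Real.logb_mul (by positivity) (by simp)]
    ring

/-- A string is recovered from its phrase list by concatenation, so at most `(c |A|) ^ c` strings
have `c` phrases. The factor `k + 1` in the weight pays for the `k + 1` possible values of `c`. -/
theorem isSubProb_lzWeight {A : Type*} [Fintype A] [DecidableEq A] [Nonempty A] (k : ℕ) :
    IsSubProb (lzWeight : List A → ℝ) k where
  nonneg w := (lzWeight_pos w).le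
  sum_le S hS := by
    have hmap : ∀ w ∈ S, phraseCount w ∈ Finset.range (k + 1) := fun w hw =>
      Finset.mem_range.2 (Nat.lt_succ_of_le (hS w hw ▸ phraseCount_le_length w))
    rw [← Finset.sum_fiberwise_of_maps_to hmap]
    calc ∑ c ∈ Finset.range (k + 1), ∑ w ∈ S with phraseCount w = c, lzWeight w
        ≤ ∑ c ∈ Finset.range (k + 1), ((k : ℝ) + 1)⁻¹ := by
          refine Finset.sum_le_sum fun c _ => ?_
          have hc : ({w ∈ S | phraseCount w = c} : Finset (List A)).card ≤
              (c * Fintype.card A) ^ c := by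
            refine le_trans ?_ (card_parsings_le A c)
            refine Finset.card_le_card_of_injOn parse (fun w hw => ?_) fun w _ w' _ h => ?_
            · obtain ⟨_, rfl⟩ := Finset.mem_filter.1 hw
              exact (isParsing_parse w).mem_parsings
            · rw [← flatten_parse w, h, flatten_parse]
          rw [Finset.sum_congr rfl
            (g := fun _ => ((k : ℝ) + 1)⁻¹ * (((c * Fintype.card A) ^ c : ℕ) : ℝ)⁻¹) fun w hw => by
              obtain ⟨hw', rfl⟩ := Finset.mem_filter.1 hw
              rw [lzWeight, hS w hw', Nat.cast_mul, mul_inv, Nat.cast_add_one],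
            Finset.sum_const, nsmul_eq_mul, mul_left_comm]
          refine mul_le_of_le_one_right (by positivity) ?_
          exact mul_inv_le_one_of_le₀ (by exact_mod_cast hc) (by positivity)
      _ = 1 := by
          rw [Finset.sum_const, Finset.card_range, nsmul_eq_mul, Nat.cast_add_one]
          exact mul_inv_cancel₀ (by positivity)

/-! ### Aligned blocks and their averages. -/

theorem block_eq_seg {A : Type*} (x : ℕ → A) (k b : ℕ) : block x k b = seg x (b * k) k :=
  (seg_eq_ofFn _ _ _).symm

theorem block_eq_cyclic_seg {A : Type*} (x : ℕ → A) {k b n : ℕ} (h : b * k + k ≤ n) :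
    block x k b = seg (fun j => x (j % n)) (b * k) k := by
  rw [seg_eq_ofFn, block]
  congr 1
  funext j
  rw [Nat.mod_eq_of_lt (by have := j.2; omega)]

theorem length_block {A : Type*} (x : ℕ → A) (k b : ℕ) : (block x k b).length = k := by
  rw [block_eq_seg, length_seg]

theorem logb_natCast_nonneg (n : ℕ) : 0 ≤ Real.logb 2 n := by
  rcases Nat.eq_zero_or_pos n with rfl | hn
  · simp
  · exact Real.logb_nonneg one_lt_two (by exact_mod_cast hn)

theorem rhoLZ_nonneg {A : Type*} [DecidableEq A] (w : List A) : 0 ≤ rhoLZ w :=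
  div_nonneg (mul_nonneg (Nat.cast_nonneg _) (logb_natCast_nonneg _)) (Nat.cast_nonneg _)

theorem logb_natCast_le {a b : ℕ} (h : a ≤ b) : Real.logb 2 a ≤ Real.logb 2 b := by
  rcases Nat.eq_zero_or_pos a with rfl | ha
  · simpa using logb_natCast_nonneg b
  · exact Real.logb_le_logb_of_le one_lt_two (by exact_mod_cast ha) (by exact_mod_cast h)

theorem rhoLZ_le {A : Type*} [DecidableEq A] (w : List A) : rhoLZ w ≤ Real.logb 2 w.length := by
  refine div_le_of_le_mul₀ (Nat.cast_nonneg _) (logb_natCast_nonneg _) ?_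
  rw [mul_comm]
  exact mul_le_mul (logb_natCast_le (phraseCount_le_length w))
    (by exact_mod_cast phraseCount_le_length w) (Nat.cast_nonneg _) (logb_natCast_nonneg _)

theorem mul_blockAverage {A : Type*} [DecidableEq A] (x : ℕ → A) {k : ℕ} (hk : 0 < k) (N : ℕ) :
    N * blockAverage x k (N * k) = ∑ b ∈ Finset.range N, rhoLZ (block x k b) := by
  rw [blockAverage, Nat.mul_div_cancel _ hk]
  rcases Nat.eq_zero_or_pos N with rfl | hN
  · simp
  · have h1 : (k : ℝ) ≠ 0 := by positivity
    have h2 : (N : ℝ) ≠ 0 := by positivity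
    push_cast
    field_simp

theorem blockAverage_nonneg {A : Type*} [DecidableEq A] (x : ℕ → A) (k n : ℕ) :
    0 ≤ blockAverage x k n :=
  mul_nonneg (by positivity) (Finset.sum_nonneg fun _ _ => rhoLZ_nonneg _)

theorem blockAverage_le {A : Type*} [DecidableEq A] (x : ℕ → A) {k N : ℕ} (hk : 0 < k)
    (hN : 0 < N) : blockAverage x k (N * k) ≤ Real.logb 2 k := by
  have hN' : (0 : ℝ) < N := by exact_mod_cast hN
  rw [← mul_le_mul_iff_right₀ hN', mul_blockAverage x hk]
  refine (Finset.sum_le_sum fun b _ => rhoLZ_le (block x k b)).trans (le_of_eq ?_)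
  simp [length_block]

theorem eventually_blockAverage_lt {A : Type*} [DecidableEq A] (x : ℕ → A) {k : ℕ} (hk : 0 < k)
    {b : ℝ} (hb : rhoK x k < b) : ∀ᶠ N in atTop, blockAverage x k (N * k) < b :=
  eventually_lt_of_limsup_lt hb
    ⟨_, eventually_map.2 ((eventually_gt_atTop 0).mono fun _ hN => blockAverage_le x hk hN)⟩

theorem rhoK_le {A : Type*} [DecidableEq A] (x : ℕ → A) (k : ℕ) {b : ℝ}
    (hb : ∀ᶠ N in atTop, blockAverage x k (N * k) ≤ b) : rhoK x k ≤ b :=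
  limsup_le_of_le (IsBoundedUnder.isCoboundedUnder_le
    ⟨0, eventually_map.2 (Eventually.of_forall fun _ => blockAverage_nonneg x k _)⟩) hb

theorem sum_range_mul_ite {k : ℕ} (hk : 0 < k) (F : ℕ → ℝ) (N : ℕ) :
    ∑ i ∈ Finset.range (N * k), (if i % k = 0 then F i else 0) =
      ∑ b ∈ Finset.range N, F (b * k) := by
  induction N with
  | zero => simp
  | succ N ih =>
    rw [Nat.succ_mul, Finset.sum_range_add, ih, Finset.sum_range_succ]
    congr 1
    rw [Finset.sum_eq_single 0]
    · simp
    · intro i hi hi0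
      rw [Nat.mul_add_mod_self_right, Nat.mod_eq_of_lt (Finset.mem_range.1 hi), if_neg hi0]
    · intro h
      exact absurd (Finset.mem_range.2 hk) h

/-! ### The entropy rate is at most the block LZ complexity, up to vanishing terms. -/

/-- Each position lies in at most `d` of the windows. -/
theorem sum_windows_le {G : ℕ → ℝ} (hG : ∀ i, 0 ≤ G i) (n d : ℕ) :
    ∑ p ∈ Finset.range n, ∑ i ∈ Finset.Ico p (p + d), G i ≤
      d * ∑ i ∈ Finset.range (n + d), G i := by
  simp only [Finset.sum_Ico_eq_sum_range, Nat.add_sub_cancel_left]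
  rw [Finset.sum_comm]
  refine (Finset.sum_le_card_nsmul _ _ (∑ i ∈ Finset.range (n + d), G i) fun j hj => ?_).trans
    (by simp)
  have hj' := Finset.mem_range.1 hj
  calc ∑ p ∈ Finset.range n, G (p + j) = ∑ i ∈ Finset.Ico j (j + n), G i := by
        rw [Finset.sum_Ico_eq_sum_range, Nat.add_sub_cancel_left]
        exact Finset.sum_congr rfl fun p _ => by rw [add_comm]
    _ ≤ _ := Finset.sum_le_sum_of_subset_of_nonneg
        (fun i hi => by simp only [Finset.mem_Ico, Finset.mem_range] at hi ⊢; omega)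
        fun i _ _ => hG i

theorem neg_logb_lzWeight_le {A : Type*} [Fintype A] [DecidableEq A] [Nonempty A] (w : List A) :
    -Real.logb 2 (lzWeight w) ≤ Real.logb 2 (w.length + 1) +
      w.length * Real.logb 2 w.length + w.length * Real.logb 2 (Fintype.card A) := by
  rw [neg_logb_lzWeight]
  have h : (phraseCount w : ℝ) ≤ w.length := by exact_mod_cast phraseCount_le_length w
  have h1 := mul_le_mul h (logb_natCast_le (phraseCount_le_length w)) (logb_natCast_nonneg _)
    (Nat.cast_nonneg _)
  have h2 := mul_le_mul_of_nonneg_right h (logb_card_nonneg A)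
  linarith

/-- The sliding-window entropy is bounded by the LZ code lengths of the aligned blocks. -/
theorem mul_cswEntropy_le_sum_lzWeight {A : Type*} [Fintype A] [DecidableEq A] (x : ℕ → A)
    {k n : ℕ} (hk : 0 < k) (hn : 0 < n) (d : ℕ) :
    n * cswEntropy x d n ≤ n * (Real.logb 2 k + 2 * k * Real.logb 2 (Fintype.card A)) +
      d * (∑ b ∈ Finset.range (n / k), -Real.logb 2 (lzWeight (block x k b)) +
        (k + d) * (Real.logb 2 (k + 1) + k * Real.logb 2 k +
          k * Real.logb 2 (Fintype.card A))) := by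
  have : Nonempty A := ⟨x 0⟩
  set z : ℕ → A := fun j => x (j % n) with hz
  set M := Real.logb 2 (k + 1) + k * Real.logb 2 k + k * Real.logb 2 (Fintype.card A) with hM
  -- Residue `0` makes the cuts in every window fall on the boundaries of the aligned blocks.
  have hmix := fun p => phaseMixture_seg (z := z) hk (isSubProb_lzWeight (A := A) k)
    (fun i => lzWeight_pos _) d p 0
  set F : ℕ → ℝ := fun i => -Real.logb 2 (lzWeight (seg z i k)) with hF
  have F0 : ∀ i, 0 ≤ F i := fun i => neg_nonneg.2 (Real.logb_nonpos one_lt_two (lzWeight_pos _).le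
    ((isSubProb_lzWeight k).le_one (length_seg _ _ _)))
  have FM : ∀ i, F i ≤ M := fun i => by
    simpa only [length_seg] using neg_logb_lzWeight_le (seg z i k)
  have M0 : 0 ≤ M := (F0 0).trans (FM 0)
  have G0 : ∀ i, 0 ≤ if i % k = 0 then F i else 0 := fun i => by split_ifs <;> simp [F0]
  refine (mul_cswEntropy_le x hn (isSubProb_phaseMixture (isSubProb_lzWeight (A := A) k) d)
    fun i _ => (hmix i).1).trans ((Finset.sum_le_sum fun i _ => (hmix i).2).trans ?_)
  rw [Finset.sum_add_distrib, Finset.sum_const, Finset.card_range, nsmul_eq_mul]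
  have hfilter : ∀ p, ∑ i ∈ Finset.Ico p (p + d) with i % k = 0 % k,
      -Real.logb 2 (lzWeight (seg z i k)) =
        ∑ i ∈ Finset.Ico p (p + d), if i % k = 0 then F i else 0 := fun p => by
    rw [Finset.sum_filter, Nat.zero_mod]
  refine add_le_add_right ((Finset.sum_congr rfl fun p _ => hfilter p).le.trans <| (sum_windows_le G0 n d).trans
    (mul_le_mul_of_nonneg_left ?_ (Nat.cast_nonneg d))) _
  have hnk := Nat.div_add_mod n k
  have hlt := Nat.mod_lt n hk
  rw [mul_comm] at hnk
  -- Past the complete aligned blocks fewer than `k + d` positions remain; each costs at most `M`.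
  obtain ⟨e, he⟩ : ∃ e, n + d = n / k * k + e := ⟨n % k + d, by omega⟩
  rw [he, Finset.sum_range_add, sum_range_mul_ite hk F]
  refine add_le_add (le_of_eq (Finset.sum_congr rfl fun b hb => ?_)) ?_
  · have h1 : (b + 1) * k ≤ n / k * k := Nat.mul_le_mul_right k (Finset.mem_range.1 hb)
    rw [hF, block_eq_cyclic_seg x (n := n) (by rw [add_mul, one_mul] at h1; omega)]
  · refine (Finset.sum_le_card_nsmul _ _ M fun i _ => ?_).trans ?_
    · split_ifs
      exacts [FM _, M0]
    · rw [Finset.card_range, nsmul_eq_mul]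
      refine mul_le_mul_of_nonneg_right ?_ M0
      have : e ≤ k + d := by omega
      exact_mod_cast this

theorem sum_neg_logb_lzWeight_le {A : Type*} [Fintype A] [DecidableEq A] (x : ℕ → A) {k : ℕ}
    (hk : 0 < k) {η : ℝ} (hη : ∀ w : List A, w.length = k → (phraseCount w : ℝ) ≤ η * k) (N : ℕ) :
    ∑ b ∈ Finset.range N, -Real.logb 2 (lzWeight (block x k b)) ≤
      N * k * (blockAverage x k (N * k) + Real.logb 2 (k + 1) / k +
        η * Real.logb 2 (Fintype.card A)) := by
  have : Nonempty A := ⟨x 0⟩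
  have hk' : (0 : ℝ) < k := by exact_mod_cast hk
  have h : ∀ b, -Real.logb 2 (lzWeight (block x k b)) ≤
      k * rhoLZ (block x k b) + (Real.logb 2 (k + 1) + η * k * Real.logb 2 (Fintype.card A)) := by
    intro b
    rw [neg_logb_lzWeight, rhoLZ, length_block, mul_div_cancel₀ _ hk'.ne']
    have := mul_le_mul_of_nonneg_right (hη _ (length_block x k b)) (logb_card_nonneg A)
    linarith
  refine (Finset.sum_le_sum fun b _ => h b).trans (le_of_eq ?_)
  rw [Finset.sum_add_distrib, ← Finset.mul_sum, ← mul_blockAverage x hk, Finset.sum_const,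
    Finset.card_range, nsmul_eq_mul]
  field_simp
  ring

theorem cswEntropySup_le_rhoK {A : Type*} [Fintype A] [DecidableEq A] (x : ℕ → A) {k : ℕ}
    (hk : 0 < k) {η : ℝ} (hη0 : 0 ≤ η)
    (hη : ∀ w : List A, w.length = k → (phraseCount w : ℝ) ≤ η * k) (d : ℕ) :
    cswEntropySup x d ≤ Real.logb 2 k + 2 * k * Real.logb 2 (Fintype.card A) +
      d * (rhoK x k + Real.logb 2 (k + 1) / k + η * Real.logb 2 (Fintype.card A)) := by
  have : Nonempty A := ⟨x 0⟩
  have hk' : (0 : ℝ) < k := by exact_mod_cast hk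
  set M := Real.logb 2 (k + 1) + k * Real.logb 2 k + k * Real.logb 2 (Fintype.card A) with hM
  set B := Real.logb 2 (k + 1) / k + η * Real.logb 2 (Fintype.card A) with hB
  have hB0 : 0 ≤ B := add_nonneg (div_nonneg (Real.logb_nonneg one_lt_two (by linarith)) hk'.le)
    (mul_nonneg hη0 (logb_card_nonneg A))
  have key : ∀ ε > 0, cswEntropySup x d ≤ Real.logb 2 k +
      2 * k * Real.logb 2 (Fintype.card A) + d * (rhoK x k + B) + d * ε + ε := by
    intro ε hε
    refine cswEntropySup_le x d ?_
    have hdiv : Tendsto (fun n : ℕ => n / k) atTop atTop := Nat.tendsto_div_const_atTop hk.ne'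
    have hlim : Tendsto (fun n : ℕ => d * ((k + d) * M) / (n : ℝ)) atTop (𝓝 0) :=
      tendsto_const_div_atTop_nhds_zero_nat _
    filter_upwards [hdiv.eventually (eventually_blockAverage_lt x hk (lt_add_of_pos_right _ hε)),
      eventually_gt_atTop 0, hlim.eventually (gt_mem_nhds hε)] with n h1 hn h2
    have hn' : (0 : ℝ) < n := by exact_mod_cast hn
    have h3 := mul_cswEntropy_le_sum_lzWeight x hk hn d
    have h4 := sum_neg_logb_lzWeight_le x hk hη (n / k)
    have h5 : ((n / k : ℕ) : ℝ) * k ≤ n := by exact_mod_cast Nat.div_mul_le_self n k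
    have h6 := blockAverage_nonneg x k (n / k * k)
    have h7 : ((n / k : ℕ) : ℝ) * k * (blockAverage x k (n / k * k) + B) ≤
        n * (rhoK x k + ε + B) :=
      mul_le_mul h5 (by linarith) (add_nonneg h6 hB0) hn'.le
    rw [add_assoc] at h4
    have h8 := mul_le_mul_of_nonneg_left (h4.trans h7) (Nat.cast_nonneg (α := ℝ) d)
    rw [div_lt_iff₀ hn'] at h2
    rw [← mul_le_mul_iff_right₀ hn']
    linarith
  rw [add_assoc (rhoK x k), ← hB]
  refine le_of_forall_pos_le_add fun ε hε => ?_
  -- The errors `d * ε'` and `ε'` then add up to `ε`.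
  refine (key (ε / (d + 1)) (by positivity)).trans (le_of_eq ?_)
  field_simp
  ring

/-- With `k` fixed, the overhead per window does not depend on `d` and vanishes on division by `d`.
-/
theorem le_rhoK_of_tendsto {A : Type*} [Fintype A] [DecidableEq A] (x : ℕ → A) {k : ℕ}
    (hk : 0 < k) {η : ℝ} (hη0 : 0 ≤ η)
    (hη : ∀ w : List A, w.length = k → (phraseCount w : ℝ) ≤ η * k) {H : ℝ}
    (hH : Tendsto (fun d : ℕ => cswEntropySup x d / (d : ℝ)) atTop (𝓝 H)) :
    H ≤ rhoK x k + Real.logb 2 (k + 1) / k + η * Real.logb 2 (Fintype.card A) := by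
  set B := rhoK x k + Real.logb 2 (k + 1) / k + η * Real.logb 2 (Fintype.card A) with hB
  have hlim : Tendsto (fun d : ℕ => (Real.logb 2 k + 2 * k * Real.logb 2 (Fintype.card A)) / (d : ℝ)
      + B) atTop (𝓝 (0 + B)) :=
    (tendsto_const_div_atTop_nhds_zero_nat _).add_const _
  rw [zero_add] at hlim
  refine le_of_tendsto_of_tendsto hH hlim ?_
  filter_upwards [eventually_gt_atTop 0] with d hd
  have hd' : (0 : ℝ) < d := by exact_mod_cast hd
  rw [div_le_iff₀ hd', add_mul, div_mul_cancel₀ _ hd'.ne', mul_comm B]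
  exact cswEntropySup_le_rhoK x hk hη0 hη d

/-! ### Ziv's inequality and the bound of block LZ complexity by entropy. -/

/-- A weight on all strings: geometric length with ratio `r`, then `Q`. -/
noncomputable def geometricWeight {A : Type*} (r : ℝ) (Q : List A → ℝ) (y : List A) : ℝ :=
  (1 - r) * r ^ y.length * Q y

/-- Phrases have varying lengths, so Ziv's inequality needs one weight for all lengths together. The
geometric factor provides it at a cost of `-log r` per symbol, small for `r` near `1`. -/
theorem sum_geometricWeight_le {A : Type*} [DecidableEq A] {r : ℝ} (h0 : 0 ≤ r) (h1 : r < 1)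
    {Q : List A → ℝ} (hQ : ∀ l, IsSubProb Q l) (S : Finset (List A)) :
    ∑ y ∈ S, geometricWeight r Q y ≤ 1 := by
  rw [← Finset.sum_fiberwise_of_maps_to (t := S.image List.length) (g := List.length)
    fun y hy => Finset.mem_image_of_mem _ hy]
  calc ∑ l ∈ S.image List.length, ∑ y ∈ S with y.length = l, geometricWeight r Q y
      ≤ ∑ l ∈ S.image List.length, (1 - r) * r ^ l := by
        refine Finset.sum_le_sum fun l _ => ?_
        rw [Finset.sum_congr rfl (g := fun y => (1 - r) * r ^ l * Q y) fun y hy => by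
          rw [geometricWeight, (Finset.mem_filter.1 hy).2], ← Finset.mul_sum]
        exact mul_le_of_le_one_right (mul_nonneg (by linarith) (pow_nonneg h0 l))
          ((hQ l).sum_le _ fun y hy => (Finset.mem_filter.1 hy).2)
    _ = (1 - r) * ∑ l ∈ S.image List.length, r ^ l := by rw [Finset.mul_sum]
    _ ≤ (1 - r) * (1 - r)⁻¹ := by
        refine mul_le_mul_of_nonneg_left ?_ (by linarith)
        rw [← tsum_geometric_of_lt_one h0 h1]
        exact (summable_geometric_of_lt_one h0 h1).sum_le_tsum _ fun l _ => pow_nonneg h0 l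
    _ = 1 := mul_inv_cancel₀ (by linarith)

/-- Ziv's inequality for a list of strings that are distinct except possibly for the last one. -/
theorem length_mul_logb_le {A : Type*} [DecidableEq A] {R : List A → ℝ}
    (hR : ∀ S : Finset (List A), ∑ y ∈ S, R y ≤ 1) {l r : List (List A)} (hl : l.Nodup)
    (hr : r.length ≤ 1) (hpos : ∀ y ∈ l ++ r, 0 < R y) :
    ((l ++ r).length : ℝ) * Real.logb 2 (l ++ r).length ≤
      (l ++ r).length + ((l ++ r).map fun y => -Real.logb 2 (R y)).sum := by
  -- The possibly repeated last phrase contributes at most one more unit of mass; the resulting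
  -- factor `2` is the source of the extra term `(l ++ r).length`.
  have hsum : ((l ++ r).map R).sum ≤ 2 := by
    rw [List.map_append, List.sum_append]
    have h1 : (l.map R).sum ≤ 1 := by
      rw [← List.sum_toFinset R hl]; exact hR _
    have h2 : (r.map R).sum ≤ 1 := by
      rcases r with _ | ⟨y, _ | _⟩
      · simp
      · simpa using hR {y}
      · simp at hr
    linarith
  generalize l ++ r = ys at hpos hsum ⊢
  rcases Nat.eq_zero_or_pos ys.length with h0 | h0
  · rw [List.length_eq_zero_iff] at h0; simp [h0]
  have hc : (0 : ℝ) < ys.length := by exact_mod_cast h0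
  have hl2 : 0 < Real.log 2 := Real.log_pos one_lt_two
  -- This is `log t ≤ t - 1` at `t = R y * c / 2`, with `c` the number of strings. Summed over the
  -- list, the terms without a logarithm are at most `0`, because the total mass is at most `2`.
  have key : ∀ y ∈ ys, Real.logb 2 ys.length - 1 ≤
      -Real.logb 2 (R y) + (ys.length / (2 * Real.log 2) * R y + -(1 / Real.log 2)) := by
    intro y hy
    have h1 := Real.log_le_sub_one_of_pos (x := R y * ys.length / 2)
      (by have := hpos y hy; positivity)
    rw [Real.log_div (mul_pos (hpos y hy) hc).ne' two_ne_zero,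
      Real.log_mul (hpos y hy).ne' hc.ne'] at h1
    rw [Real.logb, Real.logb]
    field_simp
    linarith
  have h2 := List.sum_le_sum key
  rw [List.map_const', List.sum_replicate, nsmul_eq_mul, List.sum_map_add, List.sum_map_add,
    List.sum_map_mul_left, List.map_const', List.sum_replicate, nsmul_eq_mul] at h2
  have h3 : ys.length / (2 * Real.log 2) * (ys.map R).sum ≤ ys.length / (2 * Real.log 2) * 2 :=
    mul_le_mul_of_nonneg_left hsum (by positivity)
  have h4 : (ys.length : ℝ) / (2 * Real.log 2) * 2 = ys.length * (1 / Real.log 2) := by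
    field_simp
  linarith

/-- Consecutive phrases of a segment are themselves segments on adjacent intervals, so their
position sums concatenate and only the constant is paid once per phrase. -/
theorem sum_map_le_of_flatten_eq_seg {A : Type*} {z : ℕ → A} {f : List A → ℝ} {G : ℕ → ℝ} {C : ℝ}
    (hf : ∀ p l, f (seg z p l) ≤ C + ∑ i ∈ Finset.Ico p (p + l), G i) (ys : List (List A))
    {p l : ℕ} (h : ys.flatten = seg z p l) :
    (∀ y ∈ ys, ∃ p' l', y = seg z p' l') ∧
    (ys.map f).sum ≤ ys.length * C + ∑ i ∈ Finset.Ico p (p + l), G i := by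
  induction ys generalizing p l with
  | nil =>
    have : l = 0 := by simpa using (congrArg List.length h).symm
    simp [this]
  | cons y ys ih =>
    rw [List.flatten_cons] at h
    have hlen : y.length ≤ l := by
      have := congrArg List.length h
      rw [List.length_append, length_seg] at this
      omega
    have h1 : y = seg z p y.length := by
      have := congrArg (List.take y.length) h
      rwa [List.take_left, take_seg, min_eq_left hlen] at this
    have h2 : ys.flatten = seg z (p + y.length) (l - y.length) := by
      have := congrArg (List.drop y.length) h
      rwa [List.drop_left, drop_seg] at this
    obtain ⟨h3, h4⟩ := ih h2
    refine ⟨List.forall_mem_cons.2 ⟨⟨_, _, h1⟩, h3⟩, ?_⟩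
    have h5 := hf p y.length
    rw [← h1] at h5
    rw [show p + y.length + (l - y.length) = p + l by omega] at h4
    have h6 := Finset.sum_Ico_consecutive G (Nat.le_add_right p y.length)
      (show p + y.length ≤ p + l by omega)
    rw [List.map_cons, List.sum_cons, List.length_cons, Nat.cast_add_one]
    linarith

/-- The LZ complexity of a segment is bounded by its empirical ideal code length. -/
theorem phraseCount_mul_logb_le {A : Type*} [Fintype A] [DecidableEq A] [Nonempty A] {m : ℕ}
    (hm : 0 < m) {q : List A → ℝ} (hq : IsSubProb q m) {z : ℕ → A}
    (hz : ∀ i, 0 < q (seg z i m)) {r : ℝ} (h0 : 0 < r) (h1 : r < 1) (p l : ℕ) :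
    (phraseCount (seg z p l) : ℝ) * Real.logb 2 (phraseCount (seg z p l)) ≤
      phraseCount (seg z p l) *
        (1 - Real.logb 2 (1 - r) + Real.logb 2 m + 2 * m * Real.logb 2 (Fintype.card A)) +
      ∑ i ∈ Finset.Ico p (p + l), (-Real.logb 2 r + -Real.logb 2 (q (seg z i m)) / m) := by
  have hQ := fun p l => (phaseMixture_seg hm hq hz l p 0).1
  have hR : ∀ p l, 0 < geometricWeight r (phaseMixture m q) (seg z p l) := fun p l =>
    mul_pos (mul_pos (by linarith) (pow_pos h0 _)) (hQ p l)
  have hcost : ∀ p l, -Real.logb 2 (geometricWeight r (phaseMixture m q) (seg z p l)) ≤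
      (-Real.logb 2 (1 - r) + Real.logb 2 m + 2 * m * Real.logb 2 (Fintype.card A)) +
      ∑ i ∈ Finset.Ico p (p + l), (-Real.logb 2 r + -Real.logb 2 (q (seg z i m)) / m) := by
    intro p l
    have h2 := phaseMixture_seg_average hm hq hz l p
    rw [geometricWeight, Real.logb_mul (mul_pos (by linarith) (pow_pos h0 _)).ne' (hQ p l).ne',
      Real.logb_mul (by linarith) (pow_pos h0 _).ne', Real.logb_pow, length_seg,
      Finset.sum_add_distrib, Finset.sum_const, Nat.card_Ico, nsmul_eq_mul, ← Finset.sum_div,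
      Nat.add_sub_cancel_left]
    linarith
  obtain ⟨h2, h3⟩ := sum_map_le_of_flatten_eq_seg
    (f := fun y => -Real.logb 2 (geometricWeight r (phaseMixture m q) y))
    (G := fun i => -Real.logb 2 r + -Real.logb 2 (q (seg z i m)) / m) hcost _ (flatten_parse (seg z p l))
  obtain ⟨ys, zs, hp, hy, hzs⟩ := parse_eq_append (seg z p l)
  have h4 := length_mul_logb_le
    (sum_geometricWeight_le h0.le h1 (isSubProb_phaseMixture hq)) hy hzs fun y hy => by
      obtain ⟨p', l', rfl⟩ := h2 y (hp ▸ hy)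
      exact hR p' l'
  rw [← hp] at h4
  rw [phraseCount]
  linarith

/-- Ziv's inequality is applied in every block with the same `q`, the empirical distribution of all
`N * k` symbols. The blocks tile the cycle, so the window costs add up to the full entropy; the
overhead `C` per phrase is weighted by at most `η` phrases per symbol. -/
theorem blockAverage_le_cswEntropy {A : Type*} [Fintype A] [DecidableEq A] (x : ℕ → A) {k d N : ℕ}
    (hk : 0 < k) (hd : 0 < d) (hN : 0 < N) {η : ℝ}
    (hη : ∀ w : List A, w.length = k → (phraseCount w : ℝ) ≤ η * k) {r : ℝ} (h0 : 0 < r)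
    (h1 : r < 1) :
    blockAverage x k (N * k) ≤
      η * (1 - Real.logb 2 (1 - r) + Real.logb 2 d + 2 * d * Real.logb 2 (Fintype.card A)) -
        Real.logb 2 r + cswEntropy x d (N * k) / d := by
  have : Nonempty A := ⟨x 0⟩
  have hk' : (0 : ℝ) < k := by exact_mod_cast hk
  have hN' : (0 : ℝ) < N := by exact_mod_cast hN
  have hn : 0 < N * k := Nat.mul_pos hN hk
  set C := 1 - Real.logb 2 (1 - r) + Real.logb 2 d + 2 * d * Real.logb 2 (Fintype.card A) with hC
  have hC0 : 0 ≤ C := by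
    have h2 : Real.logb 2 (1 - r) ≤ 0 := Real.logb_nonpos one_lt_two (by linarith) (by linarith)
    have h3 := logb_natCast_nonneg d
    have h4 := mul_nonneg (show (0 : ℝ) ≤ 2 * d by positivity) (logb_card_nonneg A)
    linarith
  set z : ℕ → A := fun j => x (j % (N * k)) with hz
  set G : ℕ → ℝ := fun i => -Real.logb 2 r + -Real.logb 2 (empirical x (N * k) d (seg z i d)) / d
    with hG
  have hblock : ∀ b ∈ Finset.range N, k * rhoLZ (block x k b) ≤
      η * k * C + ∑ i ∈ Finset.range k, G (b * k + i) := by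
    intro b hb
    have hb' : b * k + k ≤ N * k := by
      have := Nat.mul_le_mul_right k (Finset.mem_range.1 hb)
      rwa [Nat.succ_mul] at this
    have h2 := phraseCount_mul_logb_le hd (isSubProb_empirical x (N * k) d d) (z := z)
      (empirical_pos x hn d) h0 h1 (b * k) k
    rw [Finset.sum_Ico_eq_sum_range, Nat.add_sub_cancel_left] at h2
    rw [rhoLZ, length_block, mul_div_cancel₀ _ hk'.ne', block_eq_cyclic_seg x hb']
    have h3 := mul_le_mul_of_nonneg_right (hη (seg z (b * k) k) (length_seg _ _ _)) hC0
    linarith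
  have hsum : ∀ M, ∑ b ∈ Finset.range M, ∑ i ∈ Finset.range k, G (b * k + i) =
      ∑ i ∈ Finset.range (M * k), G i := by
    intro M
    induction M with
    | zero => simp
    | succ M ih => rw [Finset.sum_range_succ, ih, Nat.succ_mul, Finset.sum_range_add]
  have h2 := Finset.sum_le_sum hblock
  rw [← Finset.mul_sum, ← mul_blockAverage x hk, Finset.sum_add_distrib, hsum, Finset.sum_const,
    Finset.card_range, nsmul_eq_mul, hG, Finset.sum_add_distrib, ← Finset.sum_div,
    ← mul_cswEntropy x hn, Finset.sum_const, Finset.card_range, nsmul_eq_mul] at h2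
  rw [← mul_le_mul_iff_right₀ (mul_pos hk' hN')]
  refine le_trans (le_of_eq (by ring)) (h2.trans (le_of_eq ?_))
  push_cast
  ring

/-! ### Passage to the limit in `k`. -/

/-- The order of choices matters: `d` and `r` come first and determine the overhead `C`; only then
is `k` taken large enough for `η * C ≤ ε`. -/
theorem eventually_rhoK_le {A : Type*} [Fintype A] [DecidableEq A] (x : ℕ → A) {H : ℝ}
    (hH : Tendsto (fun d : ℕ => cswEntropySup x d / (d : ℝ)) atTop (𝓝 H)) {b : ℝ} (hb : H < b) :
    ∀ᶠ k in atTop, rhoK x k < b := by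
  obtain ⟨ε, hε, hεb⟩ : ∃ ε > 0, H + 5 * ε < b := ⟨(b - H) / 6, by linarith, by linarith⟩
  obtain ⟨d, hdH, hd⟩ := ((hH.eventually (gt_mem_nhds (lt_add_of_pos_right H hε))).and
    (eventually_gt_atTop 0)).exists
  have hd' : (0 : ℝ) < d := by exact_mod_cast hd
  set r : ℝ := 2 ^ (-ε) with hr
  have h0 : 0 < r := by positivity
  have h1 : r < 1 := Real.rpow_lt_one_of_one_lt_of_neg one_lt_two (by linarith)
  have hrε : Real.logb 2 r = -ε := Real.logb_rpow two_pos (by norm_num)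
  set C := 1 - Real.logb 2 (1 - r) + Real.logb 2 d + 2 * d * Real.logb 2 (Fintype.card A) with hC
  obtain ⟨K, hK⟩ := exists_phraseCount_le (A := A) (η := ε / (|C| + 1)) (by positivity)
  have hCε : ε / (|C| + 1) * C ≤ ε := by
    rw [div_mul_eq_mul_div, div_le_iff₀ (by positivity)]
    exact mul_le_mul_of_nonneg_left (by linarith [le_abs_self C]) hε.le
  filter_upwards [eventually_ge_atTop K, eventually_gt_atTop 0] with k hkK hk
  -- One `ε` each for the phrase overhead, for `-log r`, for the limsup over `n`, and for the
  -- distance from `cswEntropySup x d / d` to `H`.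
  refine (rhoK_le x k (b := H + 4 * ε) ?_).trans_lt (by linarith)
  have hsub : Tendsto (fun N : ℕ => N * k) atTop atTop :=
    tendsto_id.atTop_mul_const' hk
  filter_upwards [eventually_gt_atTop 0, hsub.eventually (eventually_cswEntropy_lt x d
    (lt_add_of_pos_right _ (mul_pos hε hd')))] with N hN hNH
  have h2 := blockAverage_le_cswEntropy x hk hd hN
    (fun w hw => by simpa only [hw] using hK w (hkK.trans hw.ge)) h0 h1
  have h3 : cswEntropy x d (N * k) / d ≤ cswEntropySup x d / d + ε := by
    rw [div_add' _ _ _ hd'.ne']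
    exact div_le_div_of_nonneg_right hNH.le hd'.le
  linarith

theorem eventually_lt_rhoK {A : Type*} [Fintype A] [DecidableEq A] (x : ℕ → A) {H : ℝ}
    (hH : Tendsto (fun d : ℕ => cswEntropySup x d / (d : ℝ)) atTop (𝓝 H)) {b : ℝ} (hb : b < H) :
    ∀ᶠ k in atTop, b < rhoK x k := by
  have : Nonempty A := ⟨x 0⟩
  obtain ⟨ε, hε, hεb⟩ : ∃ ε > 0, b + 2 * ε < H := ⟨(H - b) / 3, by linarith, by linarith⟩
  set Λ := Real.logb 2 (Fintype.card A) with hΛ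
  have hΛ0 : 0 ≤ Λ := logb_card_nonneg A
  obtain ⟨K, hK⟩ := exists_phraseCount_le (A := A) (η := ε / (Λ + 1)) (by positivity)
  have hΛε : ε / (Λ + 1) * Λ ≤ ε := by
    rw [div_mul_eq_mul_div, div_le_iff₀ (by positivity)]
    exact mul_le_mul_of_nonneg_left (by linarith) hε.le
  -- `log (k + 1) / k` is written as `log (k + 1) / (k + 1)` times the bounded factor `1 + 1 / k`,
  -- up to the constant `log 2`.
  have hlog : Tendsto (fun k : ℕ => Real.logb 2 ((k : ℝ) + 1) / k) atTop (𝓝 0) := by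
    have h1 := (Real.isLittleO_log_id_atTop.tendsto_div_nhds_zero).comp
      (tendsto_natCast_atTop_atTop.atTop_add (tendsto_const_nhds (x := (1 : ℝ))) :
        Tendsto (fun k : ℕ => (k : ℝ) + 1) atTop atTop)
    have h2 : Tendsto (fun k : ℕ => (Real.log 2)⁻¹ * (1 + 1 / (k : ℝ))) atTop
        (𝓝 ((Real.log 2)⁻¹ * (1 + 0))) :=
      (tendsto_const_nhds.add (tendsto_const_div_atTop_nhds_zero_nat 1)).const_mul _
    have h3 := h1.mul h2
    rw [zero_mul] at h3
    refine h3.congr' ?_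
    filter_upwards [eventually_gt_atTop 0] with k hk
    have hk' : (0 : ℝ) < k := by exact_mod_cast hk
    have := Real.log_pos one_lt_two
    simp only [Function.comp, id, Real.logb]
    field_simp
  filter_upwards [eventually_ge_atTop K, eventually_gt_atTop 0, hlog.eventually (gt_mem_nhds hε)]
    with k hkK hk hkε
  have h := le_rhoK_of_tendsto x hk (η := ε / (Λ + 1)) (by positivity)
    (fun w hw => by simpa only [hw] using hK w (hkK.trans hw.ge)) hH
  linarith

end LZ78

theorem mainTheorem4 {A : Type*} [Fintype A] [DecidableEq A] (x : ℕ → A) :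
    ∃ Hbar : ℝ,
      Tendsto (fun d : ℕ => LZ78.cswEntropySup x d / (d : ℝ)) atTop (𝓝 Hbar) ∧
      Tendsto (fun k : ℕ => LZ78.rhoK x k) atTop (𝓝 Hbar) := by
  have hH := (LZ78.subadditive_cswEntropySup x).tendsto_lim (LZ78.bddBelow_cswEntropySup_div x)
  exact ⟨_, hH, tendsto_order.2
    ⟨fun _ hb => LZ78.eventually_lt_rhoK x hH hb, fun _ hb => LZ78.eventually_rhoK_le x hH hb⟩⟩
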